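/- Let $p$ be a prime, let $\mathcal A=\mathbb Z/p\mathbb Z$ (discrete), let $D\ge 1$, and give the configuration space $X=\mathcal A^{\mathbb Z^D}$ the product topology and componentwise addition. For $u\in\mathbb Z^D$ let $\sigma^u:X\to X$ be the shift, $(\sigma^u a)_m=a_{u+m}$. A linear cellular automaton on $X$ is a continuous group endomorphism $F:X\to X$ that commutes with all shifts; it can be written uniquely as a shift polynomial $F=\sum_{u} f_u\,\sigma^u$ with coefficients $f_u\in\mathcal A$, only finitely many of them nonzero. Call $F$ nontrivial if at least two of the coefficients $f_u$ are nonzero. A character of $X$ is a continuous homomorphism $\chi$ from $X$ to the unit circle group. Its component $\chi_m$ at $m\in\mathbb Z^D$ is the character of $\mathcal A$ obtained by restricting $\chi$ to the $m$-th coordinate copy of $\mathcal A$ in $X$, so that $\chi(a)=\prod_m\chi_m(a_m)$ with all but finitely many $\chi_m$ trivial. The rank of $\chi$ is the number of $m$ for which $\chi_m$ is nontrivial. A set $J\subseteq\mathbb N$ has Cesàro density $1$ if $\frac1N\,\bigl|\{j\in J: 0\le j<N\}\bigr|\to 1$ as $N\to\infty$. **Theorem.** Every nontrivial linear cellular automaton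 $F$ on $\mathcal A^{\mathbb Z^D}$ is diffusive in density: for every nontrivial character $\chi$ of $\mathcal A^{\mathbb Z^D}$ there is a set $J\subseteq\mathbb N$ of Cesàro density $1$ such that $$\lim_{\substack{j\to\infty\\ j\in J}}\operatorname{rank}(\chi\circ F^j)=\infty .$$ -/

import Mathlib

open Filter Topology

noncomputable section

namespace CellAut

variable {M A : Type*} [AddCommMonoid M] [AddCommGroup A] [TopologicalSpace A]

/-- The shift `σ^e` on the configuration space `A^M`: `(σ^e a)_m = a_{e+m}`. -/
def shift (e : M) (a : M → A) : M → A := fun m => a (e + m)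

/-- A linear cellular automaton on `A^M`: a group endomorphism of `A^M` that is continuous for the
product topology and commutes with all shifts. -/
structure IsLinearCA (F : AddMonoid.End (M → A)) : Prop where
  continuous : Continuous (F : (M → A) → (M → A))
  commutes : ∀ (e : M) (a : M → A), F (shift e a) = shift e (F a)

open Classical in
/-- The component `χ_m` at `m ∈ M` of a character `χ` of `A^M`: the character of `A` obtained by
restricting `χ` to the `m`-th coordinate copy of `A`. -/
def component (χ : AddChar (M → A) Circle) (m : M) : AddChar A Circle :=
  χ.compAddMonoidHom (AddMonoidHom.single (fun _ : M => A) m)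

/-- The rank of a character of `A^M`: the number of its nontrivial components.  (This number is
finite when `χ` is continuous, see `finite_components` for `A = ℤ/n`.) -/
def rank (χ : AddChar (M → A) Circle) : ℕ := {m : M | component χ m ≠ 1}.ncard

open Classical in
/-- The set `J` of natural numbers has Cesàro density `d`. -/
def HasCesaroDensity (J : Set ℕ) (d : ℝ) : Prop :=
  Tendsto (fun N : ℕ => (((Finset.range N).filter (fun j => j ∈ J)).card : ℝ) / (N : ℝ))
    atTop (𝓝 d)

/-- `F` is diffusive in density: for every nontrivial (continuous) character `χ` of `A^M` there is
a set `J` of Cesàro density one such that `rank (χ ∘ F^j) → ∞` as `j → ∞` within `J`. -/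
def IsDiffusiveInDensity (F : AddMonoid.End (M → A)) : Prop :=
  ∀ χ : AddChar (M → A) Circle, Continuous χ → χ ≠ 1 →
    ∃ J : Set ℕ, HasCesaroDensity J 1 ∧
      Tendsto (fun j : ℕ => rank (χ.compAddMonoidHom (F ^ j))) (atTop ⊓ 𝓟 J) atTop

section ZModAlphabet

variable {n : ℕ}

/-- `f`, a finitely supported family of coefficients in `ℤ/n`, is a shift polynomial of `F`:
`F = ∑_u f_u σ^u`. -/
def IsShiftPolynomial (F : AddMonoid.End (M → ZMod n)) (f : M →₀ ZMod n) : Prop :=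
  ∀ a : M → ZMod n, F a = f.sum fun u c => c • shift u a

/-- `F` is nontrivial: its shift polynomial (which exists and is unique for every linear cellular
automaton, see `existsUnique_shiftPolynomial`) has at least two nonzero coefficients. -/
def IsNontrivial (F : AddMonoid.End (M → ZMod n)) : Prop :=
  ∃ f : M →₀ ZMod n, IsShiftPolynomial F f ∧ 2 ≤ f.support.card

theorem exists_finset_of_isOpen {ι : Type*} {S : Set (ι → ZMod n)} (hS : IsOpen S) (h0 : 0 ∈ S) :
    ∃ I : Finset ι, ∀ a : ι → ZMod n, (∀ m ∈ I, a m = 0) → a ∈ S := by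
  obtain ⟨I, u, hu, hIS⟩ := isOpen_pi_iff.1 hS 0 h0
  refine ⟨I, fun a ha => hIS fun m hm => ?_⟩
  rw [ha m hm]
  exact (hu m hm).2

open Classical in
theorem existsUnique_shiftPolynomial {F : AddMonoid.End (M → ZMod n)} (hF : IsLinearCA F) :
    ∃! f : M →₀ ZMod n, IsShiftPolynomial F f := by
  have key : ∀ (a : M → ZMod n) (m : M), F a m = F (shift m a) 0 := by
    intro a m
    rw [hF.commutes]
    simp [shift]
  have hopen : IsOpen {a : M → ZMod n | F a 0 = 0} :=
    (isOpen_discrete ({0} : Set (ZMod n))).preimage ((continuous_apply 0).comp hF.continuous)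
  obtain ⟨I, hI⟩ := exists_finset_of_isOpen hopen (by simp)
  have hloc : ∀ a : M → ZMod n, F a 0 = ∑ u ∈ I, F (Pi.single u 1) 0 * a u := by
    intro a
    have h1 : F (a - ∑ u ∈ I, Pi.single u (a u)) 0 = 0 := by
      apply hI
      intro m hm
      simp [Finset.sum_apply, Pi.single_apply, hm]
    have h2 : ∀ u, F (Pi.single u (a u)) 0 = F (Pi.single u 1) 0 * a u := by
      intro u
      obtain ⟨k, hk⟩ := ZMod.intCast_surjective (a u)
      have : (Pi.single u (a u) : M → ZMod n) = k • Pi.single u 1 := by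
        rw [← Pi.single_smul', ← hk]; simp
      rw [this, map_zsmul, ← hk]
      simp [mul_comm]
    rw [map_sub, map_sum, Pi.sub_apply, sub_eq_zero, Finset.sum_apply] at h1
    rw [h1]
    exact Finset.sum_congr rfl fun u _ => h2 u
  have hsum : ∀ (f : M →₀ ZMod n) (a : M → ZMod n) (m : M),
      (f.sum fun u c => c • shift u a) m = f.sum fun u c => c * a (u + m) := by
    intro f a m
    simp [Finsupp.sum, Finset.sum_apply, shift]
  refine ⟨Finsupp.onFinset I (fun u => if u ∈ I then F (Pi.single u 1) 0 else 0) ?_, ?_, ?_⟩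
  · intro u hu
    by_contra h
    simp [h] at hu
  · intro a
    funext m
    rw [hsum, Finsupp.onFinset_sum _ (by simp), key, hloc]
    refine Finset.sum_congr rfl fun u hu => ?_
    simp [hu, shift, add_comm]
  · intro g hg
    ext v
    have h := congrFun (hg (Pi.single v 1)) 0
    rw [hsum] at h
    have h3 : (g.sum fun u c => c * (Pi.single v 1 : M → ZMod n) (u + 0)) = g v := by
      simp [Finsupp.sum, Pi.single_apply]
      tauto
    rw [h3] at h
    rw [← h, hloc]
    simp [Pi.single_apply]

/-- A continuous character of `(ℤ/n)^M` has only finitely many nontrivial components. -/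
theorem finite_components [NeZero n] {χ : AddChar (M → ZMod n) Circle} (hχ : Continuous χ) :
    {m : M | component χ m ≠ 1}.Finite := by
  classical
  have hpow : ∀ a, ((χ a : Circle) : ℂ) ^ n = 1 := by
    intro a
    have : χ (n • a) = χ a ^ n := χ.map_nsmul_eq_pow n a
    have h0 : n • a = 0 := by funext m; simp
    rw [h0, χ.map_zero_eq_one] at this
    rw [← Circle.coe_pow, ← this, Circle.coe_one]
  have hfin : {z : ℂ | z ^ n = 1 ∧ z ≠ 1}.Finite := by
    refine (Polynomial.nthRoots n (1 : ℂ)).toFinset.finite_toSet.subset ?_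
    intro z hz
    simp [Polynomial.mem_nthRoots (NeZero.pos n), hz.1]
  have hopen : IsOpen {a : M → ZMod n | χ a = 1} := by
    have : {a : M → ZMod n | χ a = 1} =
        (fun a => ((χ a : Circle) : ℂ)) ⁻¹' {z : ℂ | z ^ n = 1 ∧ z ≠ 1}ᶜ := by
      ext a
      simp [hpow a]
      exact Circle.ext_iff
    rw [this]
    exact hfin.isClosed.isOpen_compl.preimage (continuous_subtype_val.comp hχ)
  obtain ⟨I, hI⟩ := exists_finset_of_isOpen hopen (by simp)
  refine I.finite_toSet.subset fun m hm => ?_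
  by_contra hmI
  apply hm
  ext x
  have : χ (Pi.single m x) = 1 := by
    apply hI
    intro k hk
    have : k ≠ m := fun h => hmI (h ▸ hk)
    simp [this]
  simp only [component, AddChar.compAddMonoidHom_apply, AddMonoidHom.single_apply,
    AddChar.one_apply]
  exact congrArg (fun z : Circle => (z : ℂ)) this

end ZModAlphabet

end CellAut

end

/-!
By Pontryagin duality the characters of `(ℤ/p)^M` are the elements `g` of the group algebra
`(ℤ/p)[M]`, the rank is the number of terms of `g`, and composition with a linear cellular
automaton is multiplication by its shift polynomial `f`. So the claim is that the number of terms
of `f ^ j g` tends to infinity in density.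

Let `q = p ^ s`. By Frobenius `f ^ q` is `f` with all exponents multiplied by `q`, so the part of
`f ^ (r + q k) g` on a coset of `q M`, read in the coordinate of that coset, is `f ^ k g'` with
`g'` the corresponding part of `f ^ r g`. Passing from `g` to `g'` removes the lowest base-`q`
digit of the power, does not increase the number of terms and, in `M = ℤ ^ D`, keeps the diameter
of the set of exponents at most the larger of those of `f` and `g`. For one of the digits `r ≤ 1`
the product `f ^ r g` has two or more terms, and if `q` is large against the diameters, distinct
terms lie in different cosets. Both parts survive in `f ^ (r + q k) g`, so each has strictly fewer
terms than the whole. Hence `∑_{j < q ^ n} 2 ^ (-numTerms (f ^ j g)) ≤ (q - 1 / 2) ^ n`, and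
Markov's inequality gives convergence in density.
-/

namespace CellAut

open scoped AddMonoidAlgebra

section Density

theorem HasCesaroDensity.compl {J : Set ℕ} {d : ℝ} (h : HasCesaroDensity J d) :
    HasCesaroDensity Jᶜ (1 - d) := by
  classical
  refine (h.const_sub 1).congr' ?_
  filter_upwards [eventually_ne_atTop 0] with N hN
  have hcard := Finset.card_filter_add_card_filter_not (s := Finset.range N) (fun j => j ∈ J)
  rw [Finset.card_range, ← Nat.cast_inj (R := ℝ), Nat.cast_add] at hcard
  simp only [Set.mem_compl_iff]
  rw [sub_eq_iff_eq_add, ← add_div, eq_div_iff (by exact_mod_cast hN), one_mul, ← hcard, add_comm]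

theorem tendsto_natLog_atTop {b : ℕ} (hb : 1 < b) : Tendsto (Nat.log b) atTop atTop :=
  tendsto_atTop_atTop.2 fun n => ⟨b ^ n, fun _ hj => Nat.le_log_of_pow_le hb hj⟩

open Classical in
theorem hasCesaroDensity_zero_of_tendsto_pow {B : Set ℕ} {q : ℕ} (hq : 1 < q)
    (hB : Tendsto (fun n : ℕ => (((Finset.range (q ^ n)).filter (fun j => j ∈ B)).card : ℝ) /
      (q : ℝ) ^ n) atTop (𝓝 0)) :
    HasCesaroDensity B 0 := by
  set c : ℕ → ℝ := fun N => (((Finset.range N).filter (fun j => j ∈ B)).card : ℝ)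
  have hc_mono : Monotone c := fun a b hab =>
    Nat.cast_le.2 (Finset.card_le_card (Finset.filter_subset_filter _ (Finset.range_mono hab)))
  have hlim : Tendsto (fun N => (q : ℝ) * (c (q ^ (Nat.log q N + 1)) / (q : ℝ) ^ (Nat.log q N + 1)))
      atTop (𝓝 0) := by
    simpa using (hB.comp ((tendsto_add_atTop_nat 1).comp (tendsto_natLog_atTop hq))).const_mul
      (q : ℝ)
  refine squeeze_zero' (.of_forall fun N => by positivity) ?_ hlim
  filter_upwards [eventually_ne_atTop 0] with N hN
  have hle : (q : ℝ) ^ Nat.log q N ≤ N := by exact_mod_cast Nat.pow_log_le_self q hN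
  have hlt : c N ≤ c (q ^ (Nat.log q N + 1)) := hc_mono (Nat.lt_pow_succ_log_self hq N).le
  calc c N / N ≤ c (q ^ (Nat.log q N + 1)) / (q : ℝ) ^ Nat.log q N := by
        gcongr
    _ = q * (c (q ^ (Nat.log q N + 1)) / (q : ℝ) ^ (Nat.log q N + 1)) := by
        field_simp
        rw [mul_assoc, ← pow_succ]

theorem card_filter_two_pow_lt_le (s : Finset ℕ) (w : ℕ → ℕ) (n : ℕ) :
    ((s.filter fun j => 2 ^ w j < n).card : ℝ) ≤ n * ∑ j ∈ s, (1 / 2 : ℝ) ^ w j := by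
  rw [Finset.card_filter, Nat.cast_sum, Finset.mul_sum]
  refine Finset.sum_le_sum fun j _ => ?_
  split_ifs with hj
  · rw [one_div_pow, mul_one_div, Nat.cast_one, one_le_div (by positivity)]
    exact_mod_cast hj.le
  · simp only [Nat.cast_zero]
    positivity

open Classical in
theorem exists_density_one_tendsto_atTop {w : ℕ → ℕ} {q : ℕ} (hq : 1 < q) {lam : ℝ}
    (hlam0 : 0 ≤ lam) (hlam : lam < q)
    (hw : ∀ n, ∑ j ∈ Finset.range (q ^ n), (1 / 2 : ℝ) ^ w j ≤ lam ^ n) :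
    ∃ J : Set ℕ, HasCesaroDensity J 1 ∧ Tendsto w (atTop ⊓ 𝓟 J) atTop := by
  have hq0 : (0 : ℝ) < q := by exact_mod_cast zero_lt_one.trans hq
  -- `Nat.log q j` grows so slowly that the factor `n` it costs in Markov's inequality on
  -- `[0, q ^ n)` is absorbed by the decay of `(lam / q) ^ n`.
  obtain ⟨B, mem_B⟩ : ∃ B : Set ℕ, ∀ j, j ∈ B ↔ 2 ^ w j < Nat.log q j :=
    ⟨{j | 2 ^ w j < Nat.log q j}, fun _ => Iff.rfl⟩
  have hB : HasCesaroDensity B 0 := by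
    refine hasCesaroDensity_zero_of_tendsto_pow hq ?_
    refine squeeze_zero (fun n => by positivity) (fun n => ?_)
      (tendsto_self_mul_const_pow_of_lt_one (div_nonneg hlam0 hq0.le) ((div_lt_one hq0).2 hlam))
    rw [div_pow, ← mul_div_assoc]
    gcongr
    refine le_trans ?_ ((card_filter_two_pow_lt_le _ w n).trans
      (mul_le_mul_of_nonneg_left (hw n) n.cast_nonneg))
    refine Nat.cast_le.2 (Finset.card_le_card fun j hj => ?_)
    obtain ⟨hjn, hjB⟩ := Finset.mem_filter.1 hj
    have hlog : Nat.log q j ≤ n := by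
      simpa [Nat.log_pow hq] using Nat.log_mono_right (b := q) (Finset.mem_range.1 hjn).le
    exact Finset.mem_filter.2 ⟨hjn, ((mem_B j).1 hjB).trans_le hlog⟩
  refine ⟨Bᶜ, by simpa using hB.compl, ?_⟩
  have hlog : Tendsto (fun j => Nat.log 2 (Nat.log q j)) atTop atTop :=
    (tendsto_natLog_atTop one_lt_two).comp (tendsto_natLog_atTop hq)
  refine tendsto_atTop_mono' _ (mem_inf_of_right (mem_principal.2 fun j hj => ?_))
    (hlog.mono_left inf_le_left)
  have hj : Nat.log q j ≤ 2 ^ w j := not_lt.1 ((mem_B j).not.1 hj)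
  simpa [Nat.log_pow one_lt_two] using Nat.log_mono_right (b := 2) hj

end Density

section DigitDescent

theorem sum_range_mul {α : Type*} [AddCommMonoid α] (q N : ℕ) (F : ℕ → α) :
    ∑ j ∈ Finset.range (q * N), F j =
      ∑ r ∈ Finset.range q, ∑ k ∈ Finset.range N, F (r + q * k) := by
  induction N with
  | zero => simp
  | succ N ih =>
    rw [mul_add_one, Finset.sum_range_add, ih]
    simp only [Finset.sum_range_succ, Finset.sum_add_distrib, add_comm (q * N)]

/-- A family of sequences which is closed, up to decreasing the sequences, under passing to the
subsequence `k ↦ w (r + q * k)` of indices with a prescribed lowest digit `r` in base `q`, with a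
strict decrease for at least one digit. -/
structure IsDigitDescent (q : ℕ) (S : Set (ℕ → ℕ)) : Prop where
  exists_le : ∀ w ∈ S, ∀ r < q, ∃ w' ∈ S, ∀ k, w' k ≤ w (r + q * k)
  exists_lt : ∀ w ∈ S, ∃ r < q, ∃ w' ∈ S, ∀ k, w' k < w (r + q * k)

variable {q : ℕ} {S : Set (ℕ → ℕ)}

theorem IsDigitDescent.sum_half_pow_le (hS : IsDigitDescent q S) {w : ℕ → ℕ} (hw : w ∈ S) (n : ℕ) :
    ∑ j ∈ Finset.range (q ^ n), (1 / 2 : ℝ) ^ w j ≤ ((q : ℝ) - 1 / 2) ^ n := by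
  induction n generalizing w with
  | zero => simpa using pow_le_one₀ (by norm_num) (by norm_num : (2⁻¹ : ℝ) ≤ 1)
  | succ n ih =>
    set A : ℝ := ((q : ℝ) - 1 / 2) ^ n
    have sum_le : ∀ r < q, ∑ k ∈ Finset.range (q ^ n), (1 / 2 : ℝ) ^ w (r + q * k) ≤ A := by
      intro r hr
      obtain ⟨w', hw', hle⟩ := hS.exists_le w hw r hr
      exact (Finset.sum_le_sum fun k _ =>
        pow_le_pow_of_le_one (by norm_num) (by norm_num) (hle k)).trans (ih hw')
    obtain ⟨r₀, hr₀, w₀, hw₀, hlt⟩ := hS.exists_lt w hw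
    have sum_le_half :
        ∑ k ∈ Finset.range (q ^ n), (1 / 2 : ℝ) ^ w (r₀ + q * k) ≤ 1 / 2 * A := by
      refine le_trans ?_ (mul_le_mul_of_nonneg_left (ih hw₀) (by norm_num))
      rw [Finset.mul_sum]
      refine Finset.sum_le_sum fun k _ => ?_
      rw [← pow_succ']
      exact pow_le_pow_of_le_one (by norm_num) (by norm_num) (hlt k)
    have sum_others_le : ∑ r ∈ (Finset.range q).erase r₀,
        ∑ k ∈ Finset.range (q ^ n), (1 / 2 : ℝ) ^ w (r + q * k) ≤ ((q : ℝ) - 1) * A := by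
      refine (Finset.sum_le_card_nsmul _ _ A fun r hr =>
        sum_le r (Finset.mem_range.1 (Finset.mem_of_mem_erase hr))).trans_eq ?_
      rw [Finset.card_erase_of_mem (Finset.mem_range.2 hr₀), Finset.card_range, nsmul_eq_mul,
        Nat.cast_pred (by lia)]
    rw [pow_succ' q, sum_range_mul, ← Finset.add_sum_erase _ _ (Finset.mem_range.2 hr₀)]
    calc _ ≤ 1 / 2 * A + ((q : ℝ) - 1) * A := add_le_add sum_le_half sum_others_le
      _ = ((q : ℝ) - 1 / 2) ^ (n + 1) := by rw [pow_succ]; ring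

theorem IsDigitDescent.exists_density_one_tendsto_atTop (hS : IsDigitDescent q S) (hq : 1 < q)
    {w : ℕ → ℕ} (hw : w ∈ S) :
    ∃ J : Set ℕ, HasCesaroDensity J 1 ∧ Tendsto w (atTop ⊓ 𝓟 J) atTop := by
  have hq' : (1 : ℝ) < q := by exact_mod_cast hq
  exact CellAut.exists_density_one_tendsto_atTop hq (by linarith) (by linarith)
    (hS.sum_half_pow_le hw)

end DigitDescent

section NumTerms

variable {R M N : Type*} [Semiring R]

/-- The number of terms of an element of an additive monoid algebra, i.e. the Hamming weight of its
family of coefficients. -/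
def numTerms (g : R[M]) : ℕ := g.coeff.support.card

theorem numTerms_pos {g : R[M]} : 0 < numTerms g ↔ g ≠ 0 := by
  simp [numTerms, Finset.card_pos, Finsupp.support_nonempty_iff]

theorem numTerms_mapDomain {e : M → N} (he : Function.Injective e) (g : R[M]) :
    numTerms (g.mapDomain e) = numTerms g := by
  classical
  rw [numTerms, AddMonoidAlgebra.coeff_mapDomain, Finsupp.mapDomain_support_of_injective he,
    Finset.card_image_of_injective _ he, numTerms]

theorem numTerms_comapDomain_le {e : M → N} (he : Function.Injective e) (g : R[N]) :
    numTerms (g.comapDomain e he) ≤ numTerms g :=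
  Finset.card_le_card_of_injOn e (fun y hy => by simpa using hy) he.injOn

theorem numTerms_comapDomain_add_le {e e' : M → N} (he : Function.Injective e)
    (he' : Function.Injective e') (hdisj : ∀ y y', e y ≠ e' y') (g : R[N]) :
    numTerms (g.comapDomain e he) + numTerms (g.comapDomain e' he') ≤ numTerms g := by
  classical
  rw [numTerms, numTerms, ← Finset.card_image_of_injective _ he,
    ← Finset.card_image_of_injective _ he', ← Finset.card_union_of_disjoint]
  · refine Finset.card_le_card (Finset.union_subset ?_ ?_) <;>
      exact Finset.image_subset_iff.2 fun y hy => by simpa using hy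
  · simp only [Finset.disjoint_left, Finset.mem_image]
    rintro _ ⟨y, -, rfl⟩ ⟨y', -, h⟩
    exact hdisj y y' h.symm

theorem exists_le_one_two_le_numTerms_pow_mul [AddGroup M] [NoZeroDivisors R] {f g : R[M]}
    (hf : 2 ≤ numTerms f) (hg : g ≠ 0) : ∃ r ≤ 1, 2 ≤ numTerms (f ^ r * g) := by
  by_cases hg2 : 2 ≤ numTerms g
  · exact ⟨0, zero_le_one, by simpa using hg2⟩
  have hg1 : g.coeff.support.card = 1 := by
    have := numTerms_pos.2 hg
    unfold numTerms at *
    lia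
  obtain ⟨u, b, hb, hgu⟩ := Finsupp.card_support_eq_one'.1 hg1
  obtain rfl : g = .single u b := AddMonoidAlgebra.coeff_injective hgu
  refine ⟨1, le_rfl, ?_⟩
  rw [pow_one, numTerms, AddMonoidAlgebra.support_coeff_mul_single _ _ (by simp [hb])]
  simpa [numTerms] using hf

end NumTerms

section CosetPart

variable {R M : Type*} [Semiring R] [AddCommGroup M] [IsAddTorsionFree M]

theorem add_nsmul_injective (q : ℕ) [NeZero q] (c : M) :
    Function.Injective fun y : M => c + q • y :=
  (add_right_injective c).comp (nsmul_right_injective (NeZero.ne q))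

/-- The part of `g` supported on the coset `c + qM`, read as an element of the group algebra through
`y ↦ c + q • y`: its coefficient at `y` is the coefficient of `g` at `c + q • y`.  In one variable
and characteristic `q` these are the Cartier operators. -/
noncomputable def cosetPart (q : ℕ) [NeZero q] (c : M) (g : R[M]) : R[M] :=
  g.comapDomain (fun y => c + q • y) (add_nsmul_injective q c)

variable (q : ℕ) [NeZero q] (c : M)

@[simp]
theorem coeff_cosetPart (g : R[M]) (y : M) :
    (cosetPart q c g).coeff y = g.coeff (c + q • y) := rfl

theorem cosetPart_ne_zero {g : R[M]} (hc : g.coeff c ≠ 0) : cosetPart q c g ≠ 0 := by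
  intro h
  have : (cosetPart q c g).coeff 0 = 0 := by rw [h]; rfl
  exact hc (by simpa using this)

theorem cosetPart_add (g g' : R[M]) :
    cosetPart q c (g + g') = cosetPart q c g + cosetPart q c g' :=
  AddMonoidAlgebra.comapDomain_add ..

theorem cosetPart_single_mul (v : M) (b : R) (g : R[M]) :
    cosetPart q c (.single (q • v) b * g) = .single v b * cosetPart q c g := by
  ext y
  rw [coeff_cosetPart, AddMonoidAlgebra.coeff_single_mul_apply,
    AddMonoidAlgebra.coeff_single_mul_apply, coeff_cosetPart, smul_add, smul_neg, add_left_comm]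

theorem cosetPart_mapDomain_nsmul_mul (h g : R[M]) :
    cosetPart q c (h.mapDomain (q • ·) * g) = h * cosetPart q c g := by
  induction h using AddMonoidAlgebra.induction_linear with
  | zero => simp [cosetPart]
  | add h h' hh hh' => rw [AddMonoidAlgebra.mapDomain_add, add_mul, cosetPart_add, hh, hh', add_mul]
  | single v b => rw [AddMonoidAlgebra.mapDomain_single, cosetPart_single_mul]

end CosetPart

section Frobenius

variable {p : ℕ} [Fact p.Prime] {M : Type*}

theorem pow_prime_pow_eq_mapDomain [AddCommMonoid M] (f : (ZMod p)[M]) (s : ℕ) :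
    f ^ p ^ s = f.mapDomain (p ^ s • ·) := by
  have : CharP (ZMod p)[M] p :=
    charP_of_injective_algebraMap (algebraMap (ZMod p) (ZMod p)[M]).injective p
  induction f using AddMonoidAlgebra.induction_linear with
  | zero => simp [(Fact.out : p.Prime).ne_zero]
  | add f g hf hg => rw [add_pow_char_pow, hf, hg, AddMonoidAlgebra.mapDomain_add]
  | single u a =>
    rw [AddMonoidAlgebra.single_pow, AddMonoidAlgebra.mapDomain_single, ZMod.pow_card_pow]

theorem cosetPart_pow_mul [AddCommGroup M] [IsAddTorsionFree M] (f g : (ZMod p)[M]) (s r k : ℕ)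
    (c : M) :
    cosetPart (p ^ s) c (f ^ (r + p ^ s * k) * g) = f ^ k * cosetPart (p ^ s) c (f ^ r * g) := by
  rw [add_comm, pow_add, mul_comm (p ^ s), pow_mul, pow_prime_pow_eq_mapDomain, mul_assoc,
    cosetPart_mapDomain_nsmul_mul]

end Frobenius

section Width

variable {R M : Type*}

/-- The diameter of the set of exponents of `g`. -/
noncomputable def width [Semiring R] [PseudoMetricSpace M] (g : R[M]) : ℝ :=
  Metric.diam (g.coeff.support : Set M)

theorem width_nonneg [Semiring R] [PseudoMetricSpace M] (g : R[M]) : 0 ≤ width g :=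
  Metric.diam_nonneg

theorem dist_le_width [Semiring R] [PseudoMetricSpace M] {g : R[M]} {u v : M}
    (hu : g.coeff u ≠ 0) (hv : g.coeff v ≠ 0) : dist u v ≤ width g :=
  Metric.dist_le_diam_of_mem g.coeff.support.finite_toSet.isBounded
    (by simpa using hu) (by simpa using hv)

theorem width_le [Semiring R] [PseudoMetricSpace M] {g : R[M]} {d : ℝ} (hd : 0 ≤ d)
    (h : ∀ u v, g.coeff u ≠ 0 → g.coeff v ≠ 0 → dist u v ≤ d) : width g ≤ d :=
  Metric.diam_le_of_forall_dist_le hd fun u hu v hv => h u v (by simpa using hu) (by simpa using hv)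

variable [SeminormedAddCommGroup M]

theorem width_mul_le [Semiring R] (g h : R[M]) : width (g * h) ≤ width g + width h := by
  classical
  refine width_le (add_nonneg (width_nonneg g) (width_nonneg h)) fun u v hu hv => ?_
  obtain ⟨u₁, hu₁, u₂, hu₂, rfl⟩ := Finset.mem_add.1
    (AddMonoidAlgebra.support_coeff_mul_subset g h (Finsupp.mem_support_iff.2 hu))
  obtain ⟨v₁, hv₁, v₂, hv₂, rfl⟩ := Finset.mem_add.1
    (AddMonoidAlgebra.support_coeff_mul_subset g h (Finsupp.mem_support_iff.2 hv))
  rw [Finsupp.mem_support_iff] at hu₁ hu₂ hv₁ hv₂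
  exact (dist_add_add_le _ _ _ _).trans
    (add_le_add (dist_le_width hu₁ hv₁) (dist_le_width hu₂ hv₂))

theorem width_pow_mul_le [Semiring R] (f g : R[M]) (r : ℕ) :
    width (f ^ r * g) ≤ r * width f + width g := by
  induction r with
  | zero => simp
  | succ r ih =>
    calc width (f ^ (r + 1) * g) ≤ width f + width (f ^ r * g) := by
          rw [pow_succ', mul_assoc]
          exact width_mul_le _ _
      _ ≤ (r + 1 : ℕ) * width f + width g := by push_cast; linarith

variable [NormSMulClass ℤ M]

theorem dist_add_nsmul_add_nsmul (q : ℕ) (c y y' : M) :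
    dist (c + q • y) (c + q • y') = q * dist y y' := by
  rw [dist_add_left, ← natCast_zsmul, ← natCast_zsmul, dist_smul₀, Int.norm_natCast]

variable [Semiring R] [IsAddTorsionFree M]

theorem width_cosetPart_le (q : ℕ) [NeZero q] (c : M) (g : R[M]) :
    width (cosetPart q c g) ≤ width g / q := by
  have hq : (0 : ℝ) < q := by exact_mod_cast NeZero.pos q
  refine width_le (div_nonneg (width_nonneg g) hq.le) fun y y' hy hy' => ?_
  rw [le_div_iff₀' hq, ← dist_add_nsmul_add_nsmul q c]
  exact dist_le_width hy hy'

theorem width_cosetPart_pow_mul_le {f g : R[M]} {d : ℝ} (hf : width f ≤ d) (hg : width g ≤ d)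
    {q r : ℕ} [NeZero q] (hr : r < q) (c : M) : width (cosetPart q c (f ^ r * g)) ≤ d := by
  have hq : (0 : ℝ) < q := by exact_mod_cast NeZero.pos q
  have hd : 0 ≤ d := (width_nonneg f).trans hf
  refine (width_cosetPart_le q c _).trans ((div_le_iff₀' hq).2 ?_)
  calc width (f ^ r * g) ≤ r * d + d := (width_pow_mul_le f g r).trans (by gcongr)
    _ = ((r + 1 : ℕ) : ℝ) * d := by push_cast; ring
    _ ≤ q * d := by gcongr; exact hr

end Width

section PowerGrowth

variable {p : ℕ} [Fact p.Prime] {ι : Type*}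

theorem one_le_dist_of_ne [Fintype ι] {u v : ι → ℤ} (h : u ≠ v) : 1 ≤ dist u v := by
  obtain ⟨i, hi⟩ := Function.ne_iff.1 h
  exact (Int.pairwise_one_le_dist hi).trans (dist_le_pi_dist u v i)

theorem add_nsmul_ne_add_nsmul [Fintype ι] {q : ℕ} {u v : ι → ℤ} (huv : u ≠ v)
    (hq : dist u v < q) (y y' : ι → ℤ) : u + q • y ≠ v + q • y' := by
  intro h
  have hdist : dist u v = q * dist y' y := by
    rw [← dist_add_nsmul_add_nsmul q u y' y, h, dist_add_right]
  have hy : y' ≠ y := by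
    rintro rfl
    exact huv (add_right_cancel h)
  nlinarith [one_le_dist_of_ne hy, q.cast_nonneg (α := ℝ)]

theorem numTerms_cosetPart_add_le {R : Type*} [Semiring R] [Fintype ι] {q : ℕ} [NeZero q]
    {u v : ι → ℤ} (huv : u ≠ v) (hq : dist u v < q) (g : R[ι → ℤ]) :
    numTerms (cosetPart q u g) + numTerms (cosetPart q v g) ≤ numTerms g :=
  numTerms_comapDomain_add_le _ _ (add_nsmul_ne_add_nsmul huv hq) g

theorem isDigitDescent_numTerms_pow_mul [Fintype ι] {f : (ZMod p)[ι → ℤ]} (hf2 : 2 ≤ numTerms f)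
    {d : ℝ} (hf : width f ≤ d) {s : ℕ} (hs : 2 * d < (p ^ s : ℕ)) :
    IsDigitDescent (p ^ s)
      {w | ∃ g : (ZMod p)[ι → ℤ], g ≠ 0 ∧ width g ≤ d ∧ w = fun j => numTerms (f ^ j * g)} where
  exists_le := by
    rintro _ ⟨g, hg, hgd, rfl⟩ r hr
    have hf0 : f ≠ 0 := numTerms_pos.1 (by lia)
    obtain ⟨u, hu⟩ := Finsupp.ne_iff.1
      (AddMonoidAlgebra.coeff_eq_zero.not.2 (mul_ne_zero (pow_ne_zero r hf0) hg))
    refine ⟨_, ⟨cosetPart (p ^ s) u (f ^ r * g), cosetPart_ne_zero _ _ hu,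
      width_cosetPart_pow_mul_le hf hgd hr u, rfl⟩, fun k => ?_⟩
    rw [← cosetPart_pow_mul]
    exact numTerms_comapDomain_le _ _
  exists_lt := by
    rintro _ ⟨g, hg, hgd, rfl⟩
    have hf0 : f ≠ 0 := numTerms_pos.1 (by lia)
    have hf_nonneg := width_nonneg f
    obtain ⟨r, hr, hr2⟩ := exists_le_one_two_le_numTerms_pow_mul hf2 hg
    obtain ⟨u, hu, v, hv, huv⟩ := Finset.one_lt_card.1 hr2
    rw [Finsupp.mem_support_iff] at hu hv
    have hr' : (r : ℝ) ≤ 1 := by exact_mod_cast hr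
    have hdist : dist u v < (p ^ s : ℕ) :=
      calc dist u v ≤ r * width f + width g := (dist_le_width hu hv).trans (width_pow_mul_le f g r)
        _ ≤ 1 * d + d := by gcongr
        _ < (p ^ s : ℕ) := by linarith
    have hr_lt : r < p ^ s := hr.trans_lt (by exact_mod_cast (one_le_dist_of_ne huv).trans_lt hdist)
    refine ⟨r, hr_lt, _, ⟨cosetPart (p ^ s) u (f ^ r * g), cosetPart_ne_zero _ _ hu,
      width_cosetPart_pow_mul_le hf hgd hr_lt u, rfl⟩, fun k => ?_⟩
    have hpos : 0 < numTerms (cosetPart (p ^ s) v (f ^ (r + p ^ s * k) * g)) := by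
      rw [numTerms_pos, cosetPart_pow_mul]
      exact mul_ne_zero (pow_ne_zero k hf0) (cosetPart_ne_zero _ _ hv)
    have hadd := numTerms_cosetPart_add_le huv hdist (f ^ (r + p ^ s * k) * g)
    rw [cosetPart_pow_mul f g s r k u] at hadd
    lia

theorem exists_density_one_tendsto_numTerms_of_int [Finite ι] {f g : (ZMod p)[ι → ℤ]}
    (hf2 : 2 ≤ numTerms f) (hg : g ≠ 0) :
    ∃ J : Set ℕ, HasCesaroDensity J 1 ∧
      Tendsto (fun j => numTerms (f ^ j * g)) (atTop ⊓ 𝓟 J) atTop := by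
  have := Fintype.ofFinite ι
  set d := max (width f) (width g)
  have hd : 0 ≤ d := (width_nonneg f).trans (le_max_left _ _)
  obtain ⟨s, hs⟩ := pow_unbounded_of_one_lt (2 * d + 1)
    (Nat.one_lt_cast.2 (Fact.out : p.Prime).one_lt)
  rw [← Nat.cast_pow] at hs
  have hq : 1 < p ^ s := by exact_mod_cast (show (1 : ℝ) < (p ^ s : ℕ) by linarith)
  exact (isDigitDescent_numTerms_pow_mul hf2 (le_max_left _ _)
    (by linarith)).exists_density_one_tendsto_atTop hq ⟨g, hg, le_max_right _ _, rfl⟩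

variable {M : Type*} [AddCommGroup M] [IsAddTorsionFree M]

theorem exists_injective_addMonoidHom_subset_range (s : Finset M) :
    ∃ (D : ℕ) (φ : (Fin D → ℤ) →+ M), Function.Injective φ ∧ (s : Set M) ⊆ Set.range φ := by
  let H := Submodule.span ℤ (s : Set M)
  let b := Module.finBasis ℤ H
  refine ⟨_, (H.subtype ∘ₗ b.equivFun.symm.toLinearMap).toAddMonoidHom,
    H.injective_subtype.comp b.equivFun.symm.injective, fun m hm => ?_⟩
  exact ⟨b.equivFun ⟨m, Submodule.subset_span hm⟩, by simp⟩

theorem exists_density_one_tendsto_numTerms_pow_mul {f g : (ZMod p)[M]}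
    (hf2 : 2 ≤ numTerms f) (hg : g ≠ 0) :
    ∃ J : Set ℕ, HasCesaroDensity J 1 ∧
      Tendsto (fun j => numTerms (f ^ j * g)) (atTop ⊓ 𝓟 J) atTop := by
  classical
  obtain ⟨D, φ, hφ, hrange⟩ :=
    exists_injective_addMonoidHom_subset_range (f.coeff.support ∪ g.coeff.support)
  rw [Finset.coe_union, Set.union_subset_iff] at hrange
  obtain ⟨f', rfl⟩ : ∃ f', AddMonoidAlgebra.mapDomainRingHom (ZMod p) φ f' = f :=
    ⟨_, AddMonoidAlgebra.mapDomain_comapDomain hrange.1 hφ⟩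
  obtain ⟨g', rfl⟩ : ∃ g', AddMonoidAlgebra.mapDomainRingHom (ZMod p) φ g' = g :=
    ⟨_, AddMonoidAlgebra.mapDomain_comapDomain hrange.2 hφ⟩
  have hg' : g' ≠ 0 := by
    rintro rfl
    exact hg (map_zero _)
  have numTerms_map (h : (ZMod p)[Fin D → ℤ]) :
      numTerms (AddMonoidAlgebra.mapDomainRingHom (ZMod p) φ h) = numTerms h :=
    numTerms_mapDomain hφ h
  rw [numTerms_map] at hf2
  simp only [← map_pow, ← map_mul, numTerms_map]
  exact exists_density_one_tendsto_numTerms_of_int hf2 hg'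

end PowerGrowth

section Pairing

variable {R M : Type*}

/-- The pairing `∑ m, G m * a m` of an element `G` of the monoid algebra with a configuration. -/
noncomputable def pairing [CommSemiring R] (G : R[M]) : (M → R) →ₗ[R] R :=
  (Finsupp.bilinearCombination R R).flip G.coeff

section CommSemiring

variable [CommSemiring R]

theorem pairing_apply (G : R[M]) (a : M → R) :
    pairing G a = ∑ m ∈ G.coeff.support, G.coeff m * a m := rfl

theorem pairing_zero (a : M → R) : pairing (0 : R[M]) a = 0 := by
  simp [pairing]

theorem pairing_add (G G' : R[M]) (a : M → R) :
    pairing (G + G') a = pairing G a + pairing G' a := by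
  simp [pairing]

theorem pairing_single (m : M) (c : R) (a : M → R) : pairing (.single m c) a = c * a m := by
  simp [pairing]

theorem pairing_pi_single [DecidableEq M] (G : R[M]) (m : M) (x : R) :
    pairing G (Pi.single m x) = G.coeff m * x := by
  induction G using AddMonoidAlgebra.induction_linear with
  | zero => simp [pairing_zero]
  | add G G' hG hG' => simp [pairing_add, hG, hG', add_mul]
  | single k b =>
    rw [pairing_single, AddMonoidAlgebra.coeff_single]
    obtain rfl | hkm := eq_or_ne k m <;> simp [*]

theorem continuous_pairing [TopologicalSpace R] [IsTopologicalSemiring R] (G : R[M]) :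
    Continuous (pairing G) := by
  simp only [funext (pairing_apply G)]
  fun_prop

end CommSemiring

variable [CommRing R] [AddCommMonoid M]

theorem pairing_smul_shift (G : R[M]) (u : M) (c : R) (a : M → R) :
    pairing G (c • shift u a) = pairing (.single u c * G) a := by
  induction G using AddMonoidAlgebra.induction_linear with
  | zero => simp [pairing_zero]
  | add G G' hG hG' => rw [mul_add, pairing_add, pairing_add, hG, hG']
  | single m b =>
    simp only [AddMonoidAlgebra.single_mul_single, pairing_single, Pi.smul_apply, smul_eq_mul,
      shift, mul_left_comm, mul_assoc]

theorem pairing_sum_shift (G : R[M]) (f : M →₀ R) (a : M → R) :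
    pairing G (f.sum fun u c => c • shift u a) = pairing (.ofCoeff f * G) a := by
  classical
  induction f using Finsupp.induction_linear with
  | zero => simp [pairing_zero]
  | add f f' hf hf' =>
    rw [Finsupp.sum_add_index' (by simp) fun u c c' => add_smul c c' (shift u a), map_add, hf, hf',
      AddMonoidAlgebra.ofCoeff_add, add_mul, pairing_add]
  | single u c =>
    rw [Finsupp.sum_single_index (zero_smul R (shift u a)), pairing_smul_shift]
    rfl

end Pairing

section Characters

variable {M : Type*}

theorem component_apply {A : Type*} [AddCommGroup A] [DecidableEq M]
    (χ : AddChar (M → A) Circle) (m : M) (x : A) : component χ m x = χ (Pi.single m x) := by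
  simp only [component, AddChar.compAddMonoidHom_apply, AddMonoidHom.single_apply]
  congr!

theorem ext_component {A : Type*} [AddCommGroup A] [TopologicalSpace A]
    {χ ψ : AddChar (M → A) Circle} (hχ : Continuous χ) (hψ : Continuous ψ)
    (h : ∀ m, component χ m = component ψ m) : χ = ψ := by
  classical
  ext1 a
  have hasSum_single_apply : HasSum (fun m => (Pi.single m (a m) : M → A)) a :=
    Pi.hasSum.2 fun k => by
      simpa using hasSum_single (f := fun m => (Pi.single m (a m) : M → A) k) k
        fun m hm => Pi.single_eq_of_ne hm.symm _
  have hasSum_χ := hasSum_single_apply.map χ.toAddMonoidHom hχ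
  have hasSum_ψ := hasSum_single_apply.map ψ.toAddMonoidHom hψ
  have : T2Space (Additive Circle) := inferInstanceAs (T2Space Circle)
  have comp_single_eq : (χ.toAddMonoidHom ∘ fun m => Pi.single m (a m)) =
      ψ.toAddMonoidHom ∘ fun m => Pi.single m (a m) :=
    funext fun m => by simp [← component_apply, h]
  rw [comp_single_eq] at hasSum_χ
  exact Additive.ofMul.injective (hasSum_χ.unique hasSum_ψ)

theorem zmod_surjective (n : ℕ) [NeZero n] : Function.Surjective (AddChar.zmod n) := by
  intro ψ
  obtain ⟨x, hx⟩ := AddChar.zmodAddEquiv.surjective (AddChar.circleEquivComplex ψ)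
  exact ⟨x, AddChar.circleEquivComplex.injective hx⟩

variable {n : ℕ} [NeZero n]

theorem zmod_one_apply_mul (x y : ZMod n) : AddChar.zmod n 1 (x * y) = AddChar.zmod n x y := by
  simp [AddChar.zmod]

/-- The character `a ↦ exp (2πi ⟨G, a⟩ / n)` of `(ℤ/n)^M`.  By duality every continuous character
has this form, so that characters correspond to elements of the group algebra. -/
noncomputable def charOf (G : (ZMod n)[M]) : AddChar (M → ZMod n) Circle :=
  (AddChar.zmod n 1).compAddMonoidHom (pairing G)

theorem charOf_zero : charOf (0 : (ZMod n)[M]) = 1 := by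
  ext1 a
  simp [charOf, pairing_zero]

theorem continuous_charOf (G : (ZMod n)[M]) : Continuous (charOf G) :=
  (continuous_of_discreteTopology (f := AddChar.zmod n 1)).comp (continuous_pairing G)

theorem component_charOf (G : (ZMod n)[M]) (m : M) :
    component (charOf G) m = AddChar.zmod n (G.coeff m) := by
  classical
  ext1 x
  rw [component_apply, ← zmod_one_apply_mul, ← pairing_pi_single]
  rfl

theorem rank_charOf (G : (ZMod n)[M]) : rank (charOf G) = numTerms G := by
  rw [rank, numTerms, ← Set.ncard_coe_finset]
  congr 1
  ext m
  rw [Set.mem_ofPred_eq, component_charOf, ← AddChar.zmod_zero n, Ne,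
    AddChar.zmod_injective.eq_iff]
  simp

variable [AddCommMonoid M]

theorem exists_charOf_eq {χ : AddChar (M → ZMod n) Circle} (hχ : Continuous χ) :
    ∃ G : (ZMod n)[M], charOf G = χ := by
  choose G hG using fun m => zmod_surjective n (component χ m)
  have hfin : (Function.support G).Finite := by
    refine (finite_components hχ).subset fun m hm h => hm ?_
    rw [← hG, ← AddChar.zmod_zero n] at h
    exact AddChar.zmod_injective h
  refine ⟨.ofCoeff (Finsupp.ofSupportFinite G hfin), ext_component (continuous_charOf _) hχ ?_⟩
  exact fun m => (component_charOf _ m).trans (hG m)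

variable {F : AddMonoid.End (M → ZMod n)} {f : M →₀ ZMod n}

theorem charOf_comp (hF : IsShiftPolynomial F f) (G : (ZMod n)[M]) :
    (charOf G).compAddMonoidHom F = charOf (.ofCoeff f * G) := by
  ext1 a
  exact congrArg (AddChar.zmod n 1) ((congrArg (pairing G) (hF a)).trans (pairing_sum_shift G f a))

theorem charOf_comp_pow (hF : IsShiftPolynomial F f) (G : (ZMod n)[M]) (j : ℕ) :
    (charOf G).compAddMonoidHom (F ^ j) = charOf (.ofCoeff f ^ j * G) := by
  induction j generalizing G with
  | zero =>
    rw [pow_zero, pow_zero, one_mul]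
    rfl
  | succ j ih =>
    calc (charOf G).compAddMonoidHom (F ^ (j + 1))
        = ((charOf G).compAddMonoidHom F).compAddMonoidHom (F ^ j) := by
          rw [pow_succ']
          rfl
      _ = charOf (.ofCoeff f ^ (j + 1) * G) := by
          rw [charOf_comp hF, ih, pow_succ, mul_assoc]

end Characters

end CellAut

theorem mainTheorem1_general {p : ℕ} [Fact p.Prime] {M : Type*} [AddCommGroup M]
    [IsAddTorsionFree M] {F : AddMonoid.End (M → ZMod p)} (hnt : CellAut.IsNontrivial F) :
    CellAut.IsDiffusiveInDensity F := by
  obtain ⟨f, hFf, hf2⟩ := hnt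
  intro χ hχ hχ1
  obtain ⟨G, rfl⟩ := CellAut.exists_charOf_eq hχ
  have hG : G ≠ 0 := by
    rintro rfl
    exact hχ1 CellAut.charOf_zero
  simp only [CellAut.charOf_comp_pow hFf, CellAut.rank_charOf]
  exact CellAut.exists_density_one_tendsto_numTerms_pow_mul hf2 hG

theorem mainTheorem1 (p : ℕ) [Fact p.Prime] (D : ℕ) (hD : 1 ≤ D)
    (F : AddMonoid.End ((Fin D → ℤ) → ZMod p))
    (hF : CellAut.IsLinearCA F) (hnt : CellAut.IsNontrivial F) :
    CellAut.IsDiffusiveInDensity F :=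
  mainTheorem1_general hnt
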